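/- Consider the following game of robust (noisy) online classification with labels $\mathcal{Y}=\{0,1\}$, noisy observations $\tilde{\mathcal{Y}}=\{0,1\}$, feature set $\mathcal{X}$, a finite nonempty class $\mathcal{H}\subset\{0,1\}^{\mathcal{X}}$ and horizon $T\ge 1$. For $y\in\{0,1\}$ let $e_y$ be the point mass at $y$ and $u$ the uniform distribution on $\{0,1\}$. Given mixing parameters $\lambda=(\lambda_1,\dots,\lambda_T)\in[0,1]^T$, the Tsybakov-type kernel $\mathcal{K}_\lambda$ assigns to step $t$, every feature $\mathbf{x}\in\mathcal{X}$ and label $y$ the set of distributions $$\mathcal{Q}^{(t)}_{y}=\{\lambda' e_y+(1-\lambda')u:\ \lambda_t\le\lambda'\le 1\}.$$ For $A>0$ and $0\le\alpha<1$ let $\Lambda_T(A,\alpha)$ be the set of all $\lambda\in[0,1]^T$ with $$\forall r\in(0,1/2],\qquad \frac1T\sum_{t=1}^T 1\Big\{\frac{\lambda_t}{2}\le r\Big\}\le A\,r^{\frac{\alpha}{1-\alpha}} .$$ (For $T\ge1$ this set is nonempty exactly when $A\ge 2^{\alpha/(1-\alpha)}$.) A learner $\Phi$ assigns to each $t$,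 to features $\mathbf{x}^t=(\mathbf{x}_1,\dots,\mathbf{x}_t)$ and to noisy labels $\tilde y^{t-1}=(\tilde y_1,\dots,\tilde y_{t-1})$ a distribution on $\{0,1\}$. For a set $\Lambda$ of parameter vectors define the expected minimax risk $$\tilde r_T(\mathcal{H},\Lambda)=\inf_{\Phi}\ \sup_{\lambda\in\Lambda}\ \sup_{h\in\mathcal{H}}\ \sup_{\psi^T}\ \sup_{\tilde p^T}\ \mathbb{E}\Big[\sum_{t=1}^T 1\{h(\mathbf{x}_t)\neq\hat y_t\}\Big],$$ where $\psi_t:\{0,1\}^{t-1}\to\mathcal{X}$ are arbitrary feature rules, $\mathbf{x}_t=\psi_t(\tilde y^{t-1})$, $\hat y_t\sim\Phi(\mathbf{x}^t,\tilde y^{t-1})$, and, given $\tilde y^{t-1}$, the noisy label $\tilde y_t$ is drawn from a distribution $\tilde p_t(\cdot\mid\tilde y^{t-1})\in\mathcal{Q}^{(t)}_{h(\mathbf{x}_t)}$ chosen by the adversary. Thus the learner does not know which $\lambda\in\Lambda$ is used, and $\lambda$ does not depend on the noisy labels; $\tilde r_T(\mathcal{H},\{\lambda\})$ is the expected minimax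 risk for the single kernel $\mathcal{K}_\lambda$. **Theorem.** Let $0\le\alpha<1$. 1. (Upper bound, unknown parameters.) For every $A>0$ there are $C>0$ and $k\in\mathbb{N}$, depending only on $A$ and $\alpha$, such that for every $\mathcal{X}$, every finite nonempty $\mathcal{H}\subset\{0,1\}^{\mathcal{X}}$ and every $T\ge1$, $$\tilde r_T(\mathcal{H},\Lambda_T(A,\alpha))\le C\,(1+\log T)^k(1+\log|\mathcal{H}|)^k\;T^{\frac{2(1-\alpha)}{2-\alpha}} .$$ 2. (Lower bound.) There are a set $\mathcal{X}$ and a finite nonempty class $\mathcal{H}\subset\{0,1\}^{\mathcal{X}}$ such that for every $A\ge 2^{\alpha/(1-\alpha)}$ there are $c>0$ and $k\in\mathbb{N}$ such that for every $T\ge1$ some $\lambda\in\Lambda_T(A,\alpha)$ satisfies $$\tilde r_T(\mathcal{H},\{\lambda\})\ge \frac{c}{(1+\log T)^k}\;T^{\frac{2(1-\alpha)}{2-\alpha}} .$$ -/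

import Mathlib

/-! Robust (noisy) online classification over a horizon `T`. Time steps are indexed by `Fin T`;
features live in `X`, true labels in `Y`, noisy observations in `Z`. -/

universe u

namespace NoisyOnline

/-- The set of all probability distributions over a finite set. -/
abbrev Dist (Z : Type*) [Fintype Z] : Type _ := stdSimplex ℝ Z

/-- A noisy kernel: at each time step it maps a feature and a true label to the set of
distributions over noisy observations from which the adversary may choose. -/
abbrev Kernel (X Y Z : Type*) [Fintype Z] (T : ℕ) : Type _ :=
  Fin T → X → Y → Set (Dist Z)

/-- A randomized strategy of the learner: the distribution of the prediction at time `t` as a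
function of the features up to and including time `t` and of the noisy labels before time `t`. -/
abbrev Learner (X Y Z : Type*) [Fintype Y] (T : ℕ) : Type _ :=
  (t : Fin T) → (Fin (t + 1) → X) → (Fin t → Z) → Dist Y

/-- A feature selection rule of Nature: the feature at time `t` as a function of the noisy
labels before time `t`. -/
abbrev FeatureRule (X Z : Type*) (T : ℕ) : Type _ :=
  (t : Fin T) → (Fin t → Z) → X

/-- A noise strategy of the adversary: the conditional distribution of the noisy label at time `t`
given the noisy labels before time `t`. -/
abbrev NoiseRule (Z : Type*) [Fintype Z] (T : ℕ) : Type _ :=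
  (t : Fin T) → (Fin t → Z) → Dist Z

/-- The noisy labels strictly before time `t`. -/
def past {Z : Type*} {T : ℕ} (z : Fin T → Z) (t : Fin T) : Fin t → Z :=
  fun i => z (Fin.castLE t.isLt.le i)

/-- The features up to and including time `t` along the noisy label sequence `z`. -/
def features {X Z : Type*} {T : ℕ} (ψ : FeatureRule X Z T) (z : Fin T → Z) (t : Fin T) :
    Fin (t + 1) → X :=
  fun i => ψ (Fin.castLE t.isLt i) (past z (Fin.castLE t.isLt i))

/-- The joint probability of the noisy label sequence `z` under the noise strategy `p`. -/
def jointProb {Z : Type*} [Fintype Z] {T : ℕ} (p : NoiseRule Z T) (z : Fin T → Z) : ℝ :=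
  ∏ t, p t (past z t) (z t)

open Classical in
/-- The expected cumulative error `E [∑ t, 1{h (x t) ≠ ŷ t}]`, over the noisy labels drawn by the
adversary and the randomized predictions of the learner. -/
noncomputable def expectedError {X Y Z : Type*} [Fintype Y] [Fintype Z] {T : ℕ}
    (Φ : Learner X Y Z T) (h : X → Y) (ψ : FeatureRule X Z T) (p : NoiseRule Z T) : ℝ :=
  ∑ z : Fin T → Z, jointProb p z *
    ∑ t : Fin T, ∑ y : Y,
      Φ t (features ψ z t) (past z t) y * (if h (ψ t (past z t)) ≠ y then 1 else 0)

/-- The noise strategy is allowed by the kernel when the true labels are given by `h` and the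
features by `ψ`: every conditional distribution belongs to the corresponding kernel set. -/
def Admissible {X Y Z : Type*} [Fintype Z] {T : ℕ} (K : Kernel X Y Z T) (h : X → Y)
    (ψ : FeatureRule X Z T) (p : NoiseRule Z T) : Prop :=
  ∀ (t : Fin T) (w : Fin t → Z), p t w ∈ K t (ψ t w) (h (ψ t w))

/-- The expected minimax risk when the learner only knows that the kernel belongs to the family
`𝒦`: the learner fixes a strategy, then Nature chooses the kernel in `𝒦`, the hypothesis, the
features and the noise. For a singleton family this is the minimax risk with known kernel. -/
noncomputable def minimaxRisk {X Y Z : Type*} [Fintype Y] [Fintype Z] {T : ℕ}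
    (H : Set (X → Y)) (𝒦 : Set (Kernel X Y Z T)) : ENNReal :=
  ⨅ Φ : Learner X Y Z T, ⨆ K ∈ 𝒦, ⨆ h ∈ H, ⨆ ψ : FeatureRule X Z T, ⨆ p : NoiseRule Z T,
    ⨆ _ : Admissible K h ψ p, ENNReal.ofReal (expectedError Φ h ψ p)

/-- The Tsybakov-type kernel with mixing parameters `lam t`: the true label is observed with
weight at least `lam t`, mixed with a uniform label. -/
def tsybakovKernel (X : Type*) {T : ℕ} (lam : Fin T → ℝ) : Kernel X Bool Bool T :=
  fun t _ y => {p | ∃ l : ℝ, lam t ≤ l ∧ l ≤ 1 ∧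
    (p : Bool → ℝ) = l • (Pi.single y 1 : Bool → ℝ) + (1 - l) • (fun _ => (1 / 2 : ℝ))}

/-- Mixing parameters in `[0, 1]` that satisfy the soft constraint with constant `A` and
exponent `α`: for each `r ∈ (0, 1/2]`, the fraction of the steps `t` with `lam t / 2 ≤ r` is at
most `A * r ^ (α / (1 - α))`. -/
def SoftConstraint (A α : ℝ) {T : ℕ} (lam : Fin T → ℝ) : Prop :=
  (∀ t, lam t ∈ Set.Icc (0 : ℝ) 1) ∧
  ∀ r ∈ Set.Ioc (0 : ℝ) (1 / 2),
    (1 / (T : ℝ)) * (Set.ncard {t : Fin T | lam t / 2 ≤ r} : ℝ) ≤ A * r ^ (α / (1 - α))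

/-- The family of all Tsybakov-type kernels whose mixing parameters satisfy the soft constraint. -/
def tsybakovFamily (X : Type*) (T : ℕ) (A α : ℝ) : Set (Kernel X Bool Bool T) :=
  {K | ∃ lam : Fin T → ℝ, SoftConstraint A α lam ∧ K = tsybakovKernel X lam}

end NoisyOnline

namespace NoisyOnline

open Finset

/-! ### Marginals and conditional averages of the noisy label process. -/

section Marginals

variable {Z : Type*}

/-! Put β = (1-α)/(2-α). For the upper bound, run exponential weights on the noisy 0-1 losses at
rate η. A hypothesis has nonzero excess loss over the true one only where their predictions differ,
and there the squared excess is 1 and the mean excess is at least `lam t`. Hence both the regret and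
its second-order correction are governed by the error probabilities e_t, and `hedge_regret` averages
to ∑ (λ_t - η) e_t ≤ log|H| / η (`hedgeLearner_weighted_error`). Steps with λ_t > 2η pay for
themselves; the others are counted by the soft constraint. Taking η of order T^(-β) balances 1/η²
against T η^(α/(1-α)), both of order T^(2β), without knowledge of λ.

For the lower bound, two constant hypotheses are hidden behind signal ε = T^(-β) during about ε⁻² =
T^(2β) steps. Over that time the two label laws stay statistically close (`two_point_bound`), so
every learner errs linearly often there. -/

lemma past_snoc_castSucc {T : ℕ} (w : Fin T → Z) (b : Z) (t : Fin T) :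
    past (Fin.snoc w b : Fin (T + 1) → Z) t.castSucc = past w t := by
  funext i
  exact Fin.snoc_castSucc (α := fun _ => Z) b w (Fin.castLE t.isLt.le i)

lemma past_snoc_last {T : ℕ} (w : Fin T → Z) (b : Z) :
    past (Fin.snoc w b : Fin (T + 1) → Z) (Fin.last T) = w := by
  funext i
  exact Fin.snoc_castSucc (α := fun _ => Z) b w i

variable [Fintype Z]

/-- The restriction of a noise strategy to the first `m` steps. -/
def NoiseRule.restrict {m T : ℕ} (hm : m ≤ T) (p : NoiseRule Z T) : NoiseRule Z m :=
  fun s => p (Fin.castLE hm s)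

/-- The restriction of a noisy label sequence to the first `m` steps. -/
def initSeg {m T : ℕ} (hm : m ≤ T) (z : Fin T → Z) : Fin m → Z :=
  fun i => z (Fin.castLE hm i)

lemma dist_nonneg (q : Dist Z) (b : Z) : 0 ≤ q b := q.2.1 b

lemma dist_sum (q : Dist Z) : ∑ b, q b = 1 := q.2.2

lemma jointProb_nonneg {T : ℕ} (p : NoiseRule Z T) (z : Fin T → Z) : 0 ≤ jointProb p z :=
  prod_nonneg fun _ _ => dist_nonneg _ _

lemma sum_snoc {T : ℕ} (F : (Fin (T + 1) → Z) → ℝ) :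
    ∑ z, F z = ∑ w : Fin T → Z, ∑ b, F (Fin.snoc w b) := by
  rw [← (Fin.snocEquiv fun _ : Fin (T + 1) => Z).sum_comp, Fintype.sum_prod_type, sum_comm]
  rfl

lemma jointProb_snoc {T : ℕ} (p : NoiseRule Z (T + 1)) (w : Fin T → Z) (b : Z) :
    jointProb p (Fin.snoc w b) =
      jointProb (p.restrict T.le_succ) w * p (Fin.last T) w b := by
  unfold jointProb
  rw [Fin.prod_univ_castSucc]
  congr 1
  · refine prod_congr rfl fun t _ => ?_
    rw [past_snoc_castSucc, Fin.snoc_castSucc]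
    rfl
  · rw [past_snoc_last, Fin.snoc_last]

/-- The law of the first `m` noisy labels is the one given by the first `m` noise rules. -/
lemma sum_jointProb_initSeg {m T : ℕ} (hm : m ≤ T) (p : NoiseRule Z T)
    (f : (Fin m → Z) → ℝ) :
    ∑ z, jointProb p z * f (initSeg hm z) = ∑ w, jointProb (p.restrict hm) w * f w := by
  induction T, hm using Nat.le_induction with
  | base => rfl
  | succ T hm ih =>
    have key := ih (p.restrict T.le_succ)
    rw [sum_snoc]
    refine Eq.trans (sum_congr rfl fun w _ => ?_) key
    have h1 : ∀ b, initSeg (hm.trans T.le_succ) (Fin.snoc w b : Fin (T + 1) → Z)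
        = initSeg hm w := fun b => by
      funext i
      exact Fin.snoc_castSucc (α := fun _ => Z) b w (Fin.castLE hm i)
    simp_rw [jointProb_snoc, h1, mul_right_comm]
    rw [← mul_sum, dist_sum, mul_one]

lemma sum_jointProb {T : ℕ} (p : NoiseRule Z T) : ∑ z, jointProb p z = 1 := by
  have := sum_jointProb_initSeg T.zero_le p (fun _ => 1)
  simpa [jointProb] using this

lemma sum_jointProb_past {T : ℕ} (p : NoiseRule Z T) (t : Fin T) (f : (Fin t → Z) → ℝ) :
    ∑ z, jointProb p z * f (past z t) =
      ∑ w, jointProb (p.restrict t.isLt.le) w * f w :=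
  sum_jointProb_initSeg t.isLt.le p f

/-- The tower property: the noisy label at time `t` can be averaged out given the past. -/
lemma sum_jointProb_tower {T : ℕ} (p : NoiseRule Z T) (t : Fin T)
    (f : (Fin t → Z) → Z → ℝ) :
    ∑ z, jointProb p z * f (past z t) (z t) =
      ∑ z, jointProb p z * ∑ b, p t (past z t) b * f (past z t) b := by
  have h := sum_jointProb_initSeg (m := t + 1) t.isLt p
    (fun w => f (past w (Fin.last t)) (w (Fin.last t)))
  rw [sum_snoc] at h
  refine (Eq.trans h ?_).trans
    (sum_jointProb_past p t fun w => ∑ b, p t w b * f w b).symm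
  refine sum_congr rfl fun w _ => ?_
  rw [mul_sum]
  refine sum_congr rfl fun b _ => ?_
  rw [jointProb_snoc, past_snoc_last, Fin.snoc_last, mul_assoc]
  rfl

end Marginals

/-! ### Exponential weights with a second-order regret bound. -/

section Hedge

/-- The second-order regret bound of exponential weights against a fixed expert. -/
lemma hedge_regret {ι : Type*} (S : Finset ι) (η : ℝ) (hη : 0 < η) (hη1 : η ≤ 1)
    (l : ℕ → ι → ℝ) (hl : ∀ n i, l n i ∈ Set.Icc (0 : ℝ) 1) {h : ι} (hS : h ∈ S) (T : ℕ) :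
    ∑ n ∈ range T, (∑ i ∈ S, Real.exp (-η * ∑ m ∈ range n, l m i) *
        ((l n i - l n h) - η * (l n i - l n h) ^ 2)) /
        (∑ i ∈ S, Real.exp (-η * ∑ m ∈ range n, l m i)) ≤ Real.log S.card / η := by
  set V : ℕ → ℝ := fun n => ∑ i ∈ S, Real.exp (-η * ∑ m ∈ range n, l m i) with hV
  set q : ℕ → ℝ := fun n => (∑ i ∈ S, Real.exp (-η * ∑ m ∈ range n, l m i) *
        ((l n i - l n h) - η * (l n i - l n h) ^ 2)) / V n with hq
  have hVpos : ∀ n, 0 < V n := fun n => sum_pos (fun i _ => Real.exp_pos _) ⟨h, hS⟩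
  -- Potential argument: `q n` is the weighted mean of the excess loss minus its second-order
  -- correction, and each step multiplies the total weight by at most exp(-η (l n h + q n)).
  have hinv : ∀ n, V n ≤ S.card *
      Real.exp (-η * (∑ m ∈ range n, l m h + ∑ m ∈ range n, q m)) := by
    intro n
    induction n with
    | zero => simp [hV]
    | succ n ih =>
      have hstep : V (n + 1) ≤ V n * Real.exp (-η * (l n h + q n)) := by
        have h1 : ∀ i ∈ S, Real.exp (-η * ∑ m ∈ range (n + 1), l m i) ≤
            Real.exp (-η * l n h) * (Real.exp (-η * ∑ m ∈ range n, l m i) - η *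
              (Real.exp (-η * ∑ m ∈ range n, l m i) *
                ((l n i - l n h) - η * (l n i - l n h) ^ 2))) := by
          intro i _
          obtain ⟨ha, hb⟩ := hl n i
          obtain ⟨hc, hd⟩ := hl n h
          have habs : |-η * (l n i - l n h)| ≤ 1 := by
            rw [abs_mul, abs_neg, abs_of_pos hη]
            exact mul_le_one₀ hη1 (abs_nonneg _) (abs_le.2 ⟨by linarith, by linarith⟩)
          -- The bound e^x ≤ 1 + x + x² for |x| ≤ 1 produces the quadratic term.
          have h2 := Real.abs_exp_sub_one_sub_id_le habs
          have h3 := (abs_le.1 h2).2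
          have h4 : Real.exp (-η * ∑ m ∈ range (n + 1), l m i) =
              Real.exp (-η * l n h) * (Real.exp (-η * ∑ m ∈ range n, l m i) *
                Real.exp (-η * (l n i - l n h))) := by
            rw [← Real.exp_add, ← Real.exp_add, sum_range_succ]
            ring_nf
          rw [h4]
          refine mul_le_mul_of_nonneg_left ?_ (Real.exp_pos _).le
          have h5 : Real.exp (-η * (l n i - l n h)) ≤
              1 - η * ((l n i - l n h) - η * (l n i - l n h) ^ 2) := by nlinarith
          have h6 := mul_le_mul_of_nonneg_left h5
            (Real.exp_pos (-η * ∑ m ∈ range n, l m i)).le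
          linarith
        have h2 := sum_le_sum h1
        rw [← mul_sum, sum_sub_distrib, ← mul_sum] at h2
        have h3 : (∑ i ∈ S, Real.exp (-η * ∑ m ∈ range n, l m i) *
            ((l n i - l n h) - η * (l n i - l n h) ^ 2)) = V n * q n := by
          rw [hq]
          field_simp [(hVpos n).ne']
        rw [h3] at h2
        have h4 : Real.exp (-η * (l n h + q n)) =
            Real.exp (-η * l n h) * Real.exp (-η * q n) := by
          rw [← Real.exp_add]
          ring_nf
        have h5 : 1 - η * q n ≤ Real.exp (-η * q n) := by
          linarith [Real.add_one_le_exp (-η * q n)]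
        refine h2.trans ?_
        rw [h4]
        have h6 := mul_le_mul_of_nonneg_left h5
          (mul_nonneg (Real.exp_pos (-η * l n h)).le (hVpos n).le)
        calc _ = Real.exp (-η * l n h) * V n * (1 - η * q n) := by simp only [hV]; ring
          _ ≤ _ := h6
          _ = _ := by ring
      refine (hstep.trans (mul_le_mul_of_nonneg_right ih (Real.exp_pos _).le)).trans_eq ?_
      rw [mul_assoc, ← Real.exp_add, sum_range_succ, sum_range_succ]
      ring_nf
  -- The weight of `h` alone bounds the potential below; its loss then cancels against `hinv`.
  have hlow : Real.exp (-η * ∑ m ∈ range T, l m h) ≤ V T :=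
    single_le_sum (f := fun i => Real.exp (-η * ∑ m ∈ range T, l m i))
      (fun i _ => (Real.exp_pos _).le) hS
  have h1 := hlow.trans (hinv T)
  rw [mul_add, Real.exp_add, mul_left_comm] at h1
  have h2 : 1 ≤ S.card * Real.exp (-η * ∑ m ∈ range T, q m) :=
    le_of_mul_le_mul_left (by rwa [mul_one]) (Real.exp_pos (-η * ∑ m ∈ range T, l m h))
  have hcard : (0 : ℝ) < S.card := by exact_mod_cast card_pos.2 ⟨h, hS⟩
  have h3 := Real.log_nonneg h2
  rw [Real.log_mul hcard.ne' (Real.exp_pos _).ne', Real.log_exp] at h3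
  rw [le_div_iff₀ hη]
  linarith

variable {X : Type*}

/-- The exponential weight of a hypothesis given features and noisy labels. -/
noncomputable def hedgeWeight (η : ℝ) {n : ℕ} (x : Fin (n + 1) → X) (z : Fin n → Bool)
    (h : X → Bool) : ℝ :=
  Real.exp (-η * ∑ i : Fin n, if h (x i.castSucc) ≠ z i then 1 else 0)

lemma hedgeWeight_pos (η : ℝ) {n : ℕ} (x : Fin (n + 1) → X) (z : Fin n → Bool)
    (h : X → Bool) : 0 < hedgeWeight η x z h := Real.exp_pos _

/-- The learner that follows the prediction of a hypothesis drawn by exponential weights. -/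
noncomputable def hedgeLearner (S : Finset (X → Bool)) (hS : S.Nonempty) (η : ℝ) (T : ℕ) :
    Learner X Bool Bool T := fun t x z =>
  ⟨fun y => (∑ h ∈ S with h (x (Fin.last t)) = y, hedgeWeight η x z h) /
      ∑ h ∈ S, hedgeWeight η x z h, by
    have hpos : 0 < ∑ h ∈ S, hedgeWeight η x z h :=
      sum_pos (fun h _ => hedgeWeight_pos η x z h) hS
    refine ⟨fun y => div_nonneg (sum_nonneg fun h _ => (hedgeWeight_pos η x z h).le) hpos.le,
      ?_⟩
    rw [← sum_div, sum_fiberwise, div_self hpos.ne']⟩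

end Hedge

/-! ### Upper bound: exponential weights against unknown mixing parameters. -/

section Upper

variable {X : Type*}

lemma expectedError_eq {T : ℕ} (Φ : Learner X Bool Bool T) (h : X → Bool)
    (ψ : FeatureRule X Bool T) (p : NoiseRule Bool T) :
    expectedError Φ h ψ p = ∑ t : Fin T, ∑ z, jointProb p z *
      Φ t (features ψ z t) (past z t) (!h (ψ t (past z t))) := by
  unfold expectedError
  rw [sum_comm]
  refine sum_congr rfl fun z _ => ?_
  rw [mul_sum]
  refine sum_congr rfl fun t _ => ?_
  congr 1
  rw [Fintype.sum_bool]
  cases h (ψ t (past z t)) <;> simp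

/-- The features up to time `t` as a function of the past noisy labels. -/
def featuresOfPast {T : ℕ} (ψ : FeatureRule X Bool T) (t : Fin T) (w : Fin t → Bool) :
    Fin (t + 1) → X :=
  fun i => ψ (Fin.castLE t.isLt i) fun j => w (Fin.castLE (Nat.le_of_lt_succ i.isLt) j)

lemma features_eq {T : ℕ} (ψ : FeatureRule X Bool T) (z : Fin T → Bool) (t : Fin T) :
    features ψ z t = featuresOfPast ψ t (past z t) := rfl

lemma hedgeWeight_features {T : ℕ} (η : ℝ) (ψ : FeatureRule X Bool T) (z : Fin T → Bool)
    (t : Fin T) (h : X → Bool) (l : ℕ → ℝ)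
    (hl : ∀ s : Fin T, l s = if h (ψ s (past z s)) ≠ z s then 1 else 0) :
    hedgeWeight η (features ψ z t) (past z t) h = Real.exp (-η * ∑ m ∈ range t, l m) := by
  unfold hedgeWeight
  rw [← Fin.sum_univ_eq_sum_range l]
  congr 2
  refine sum_congr rfl fun i _ => ?_
  exact (hl (Fin.castLE t.isLt.le i)).symm

/-- The regret bound of the exponential weights learner along one noisy label sequence. -/
lemma hedgeLearner_pathwise {T : ℕ} (S : Finset (X → Bool)) (hS : S.Nonempty) {η : ℝ}
    (hη : 0 < η) (hη1 : η ≤ 1) {h : X → Bool} (hh : h ∈ S) (ψ : FeatureRule X Bool T)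
    (z : Fin T → Bool) :
    ∑ t : Fin T, hedgeLearner S hS η T t (features ψ z t) (past z t)
        (!h (ψ t (past z t))) * ((if h (ψ t (past z t)) = z t then 1 else -1) - η) ≤
      Real.log S.card / η := by
  -- The value 0 beyond the horizon is a filler; the regret sum only reads n < T.
  set l : ℕ → (X → Bool) → ℝ := fun n g =>
    if hn : n < T then (if g (ψ ⟨n, hn⟩ (past z ⟨n, hn⟩)) ≠ z ⟨n, hn⟩ then 1 else 0) else 0
    with hldef
  have hl : ∀ (s : Fin T) g, l s g = if g (ψ s (past z s)) ≠ z s then 1 else 0 := by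
    intro s g
    simp [hldef]
  have hl01 : ∀ n g, l n g ∈ Set.Icc (0 : ℝ) 1 := by
    intro n g
    simp only [hldef]
    split_ifs <;> simp
  refine le_trans (le_of_eq ?_) (hedge_regret S η hη hη1 l hl01 hh T)
  rw [← Fin.sum_univ_eq_sum_range (fun n => (∑ i ∈ S, Real.exp (-η * ∑ m ∈ range n, l m i) *
        ((l n i - l n h) - η * (l n i - l n h) ^ 2)) /
        (∑ i ∈ S, Real.exp (-η * ∑ m ∈ range n, l m i)))]
  refine sum_congr rfl fun t _ => ?_
  have hw : ∀ g, Real.exp (-η * ∑ m ∈ range t, l m g) =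
      hedgeWeight η (features ψ z t) (past z t) g := fun g =>
    (hedgeWeight_features η ψ z t g (fun n => l n g) fun s => hl s g).symm
  simp_rw [hw, hl]
  change (∑ g ∈ S with g (ψ t (past z t)) = !h (ψ t (past z t)),
      hedgeWeight η (features ψ z t) (past z t) g) /
      (∑ g ∈ S, hedgeWeight η (features ψ z t) (past z t) g) * _ = _
  rw [div_mul_eq_mul_div, sum_mul, sum_filter]
  congr 1
  refine sum_congr rfl fun g _ => ?_
  -- The excess loss vanishes if `g` agrees with `h`; otherwise it is 1 or -1 as `h` matches the
  -- noisy label or not, with square 1.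
  cases g (ψ t (past z t)) <;> cases h (ψ t (past z t)) <;> cases z t <;> norm_num

lemma tsybakov_bias {T : ℕ} {lam : Fin T → ℝ} {t : Fin T} {x : X} {y : Bool} {q : Dist Bool}
    (hq : q ∈ tsybakovKernel X lam t x y) :
    lam t ≤ ∑ b, q b * (if y = b then 1 else -1) := by
  obtain ⟨l, hl, -, he⟩ := hq
  have h1 : ∀ b, q b = l * (if b = y then 1 else 0) + (1 - l) * (1 / 2) := by
    intro b
    have := congrFun he b
    simpa [Pi.single_apply] using this
  simp_rw [h1]
  refine hl.trans (le_of_eq ?_)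
  cases y <;> simp

/-- The error probability depends only on the past, so the tower property averages the sign in the
pathwise bound separately, and `tsybakov_bias` replaces it by `lam t`. -/
lemma hedgeLearner_weighted_error {T : ℕ} (S : Finset (X → Bool)) (hS : S.Nonempty) {η : ℝ}
    (hη : 0 < η) (hη1 : η ≤ 1) {h : X → Bool} (hh : h ∈ S) (ψ : FeatureRule X Bool T)
    {lam : Fin T → ℝ} (p : NoiseRule Bool T) (hp : Admissible (tsybakovKernel X lam) h ψ p) :
    ∑ t : Fin T, (lam t - η) * ∑ z, jointProb p z *
      hedgeLearner S hS η T t (features ψ z t) (past z t) (!h (ψ t (past z t))) ≤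
      Real.log S.card / η := by
  have h1 : ∑ z, jointProb p z * ∑ t : Fin T,
      hedgeLearner S hS η T t (features ψ z t) (past z t)
        (!h (ψ t (past z t))) * ((if h (ψ t (past z t)) = z t then 1 else -1) - η) ≤
      Real.log S.card / η := by
    calc _ ≤ ∑ z, jointProb p z * (Real.log S.card / η) :=
          sum_le_sum fun z _ => mul_le_mul_of_nonneg_left
            (hedgeLearner_pathwise S hS hη hη1 hh ψ z) (jointProb_nonneg p z)
      _ = _ := by rw [← sum_mul, sum_jointProb, one_mul]
  refine le_trans ?_ h1
  simp_rw [mul_sum]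
  conv_rhs => rw [sum_comm]
  refine sum_le_sum fun t _ => ?_
  have h2 := sum_jointProb_tower p t fun w b =>
    hedgeLearner S hS η T t (featuresOfPast ψ t w) w (!h (ψ t w)) *
      ((if h (ψ t w) = b then 1 else -1) - η)
  simp_rw [features_eq]
  rw [h2]
  refine sum_le_sum fun z _ => ?_
  rw [mul_left_comm]
  refine mul_le_mul_of_nonneg_left ?_ (jointProb_nonneg p z)
  have h3 := tsybakov_bias (hp t (past z t))
  have h4 := dist_nonneg (hedgeLearner S hS η T t (featuresOfPast ψ t (past z t)) (past z t))
    (!h (ψ t (past z t)))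
  have h5 := dist_sum (p t (past z t))
  calc _ ≤ (∑ b, p t (past z t) b * (if h (ψ t (past z t)) = b then 1 else -1) -
        η * ∑ b, p t (past z t) b) *
        hedgeLearner S hS η T t (featuresOfPast ψ t (past z t)) (past z t)
          (!h (ψ t (past z t))) := by
        rw [h5, mul_one]
        exact mul_le_mul_of_nonneg_right (by linarith) h4
    _ = _ := by
        rw [mul_sum, ← sum_sub_distrib, sum_mul]
        exact sum_congr rfl fun b _ => by ring

/-- The risk of exponential weights against Tsybakov-type noise. -/
lemma hedgeLearner_error {T : ℕ} (S : Finset (X → Bool)) (hS : S.Nonempty) {η : ℝ}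
    (hη : 0 < η) (hη1 : η ≤ 1) {h : X → Bool} (hh : h ∈ S) (ψ : FeatureRule X Bool T)
    {lam : Fin T → ℝ} (hlam : ∀ t, 0 ≤ lam t) (p : NoiseRule Bool T)
    (hp : Admissible (tsybakovKernel X lam) h ψ p) :
    expectedError (hedgeLearner S hS η T) h ψ p ≤
      Real.log S.card / η ^ 2 + 2 * (Set.ncard {t : Fin T | lam t / 2 ≤ η} : ℝ) := by
  rw [expectedError_eq]
  have hw := hedgeLearner_weighted_error S hS hη hη1 hh ψ p hp
  set e : Fin T → ℝ := fun t => ∑ z, jointProb p z *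
      hedgeLearner S hS η T t (features ψ z t) (past z t) (!h (ψ t (past z t))) with he
  have he0 : ∀ t, 0 ≤ e t := fun t => sum_nonneg fun z _ =>
    mul_nonneg (jointProb_nonneg p z) (dist_nonneg _ _)
  have he1 : ∀ t, e t ≤ 1 := fun t => by
    rw [← sum_jointProb p]
    refine sum_le_sum fun z _ => mul_le_of_le_one_right (jointProb_nonneg p z) ?_
    rw [← dist_sum (hedgeLearner S hS η T t (features ψ z t) (past z t))]
    exact single_le_sum (f := fun b =>
      hedgeLearner S hS η T t (features ψ z t) (past z t) b)
      (fun b _ => dist_nonneg _ b) (mem_univ _)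
  have hcard : (Set.ncard {t : Fin T | lam t / 2 ≤ η} : ℝ) =
      ∑ t : Fin T, if lam t / 2 ≤ η then (1 : ℝ) else 0 := by
    classical
    rw [sum_boole, Set.ncard_eq_toFinset_card']
    simp
  -- If λ_t > 2η, the first term already dominates e_t. Otherwise it is at least -e_t, and 2 covers
  -- the deficit since e_t ≤ 1.
  have hterm : ∀ t, e t ≤ (lam t - η) * e t / η + 2 * (if lam t / 2 ≤ η then (1 : ℝ) else 0) := by
    intro t
    have h0 := he0 t
    split_ifs with ht
    · have : -e t ≤ (lam t - η) * e t / η := by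
        rw [le_div_iff₀ hη]
        nlinarith [mul_nonneg (hlam t) h0]
      linarith [he1 t]
    · have : e t ≤ (lam t - η) * e t / η := by
        rw [le_div_iff₀ hη]
        push Not at ht
        nlinarith
      linarith
  calc ∑ t, e t ≤ ∑ t, ((lam t - η) * e t / η + 2 * (if lam t / 2 ≤ η then (1 : ℝ) else 0)) :=
        sum_le_sum fun t _ => hterm t
    _ = (∑ t, (lam t - η) * e t) / η + 2 * (Set.ncard {t : Fin T | lam t / 2 ≤ η} : ℝ) := by
        rw [sum_add_distrib, ← sum_div, ← mul_sum, hcard]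
    _ ≤ _ := by
        rw [pow_two, ← div_div]
        gcongr

lemma minimaxRisk_tsybakovFamily_le {α A : ℝ} (hα0 : 0 ≤ α) (hα1 : α < 1) (hA : 0 < A)
    (H : Set (X → Bool)) (hH : H.Finite) (hne : H.Nonempty) {T : ℕ} (hT : 1 ≤ T) :
    minimaxRisk H (tsybakovFamily X T A α) ≤
      ENNReal.ofReal ((4 * Real.log H.ncard + 2 * A) * (T : ℝ) ^ (2 * (1 - α) / (2 - α))) := by
  set β : ℝ := (1 - α) / (2 - α) with hβ
  have h1α : 0 < 1 - α := by linarith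
  have h2α : 0 < 2 - α := by linarith
  have hT1 : (1 : ℝ) ≤ T := by exact_mod_cast hT
  have hT0 : (0 : ℝ) < T := by linarith
  have hβ0 : 0 ≤ β := by positivity
  -- The half keeps η in (0, 1/2], where the soft constraint applies.
  set η : ℝ := (T : ℝ) ^ (-β) / 2 with hη
  have hTβ : (T : ℝ) ^ (-β) ≤ 1 := Real.rpow_le_one_of_one_le_of_nonpos hT1 (by linarith)
  have hTβ0 : 0 < (T : ℝ) ^ (-β) := Real.rpow_pos_of_pos hT0 _
  have hη0 : 0 < η := by positivity
  have hexp : 2 * (1 - α) / (2 - α) = 2 * β := by rw [hβ]; ring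
  have hS : hH.toFinset.Nonempty := by simpa using hne
  have hcard : hH.toFinset.card = H.ncard := (Set.ncard_eq_toFinset_card H hH).symm
  refine iInf_le_of_le (hedgeLearner hH.toFinset hS η T) ?_
  refine iSup₂_le fun K hK => iSup₂_le fun h hh => iSup_le fun ψ => iSup_le fun p =>
    iSup_le fun hp => ENNReal.ofReal_le_ofReal ?_
  obtain ⟨lam, ⟨hlam, hsoft⟩, rfl⟩ := hK
  refine (hedgeLearner_error hH.toFinset hS hη0 (by linarith) (by simpa using hh) ψ
    (fun t => (hlam t).1) p hp).trans ?_
  rw [hcard, hexp, add_mul]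
  have h1 : Real.log H.ncard / η ^ 2 = 4 * Real.log H.ncard * (T : ℝ) ^ (2 * β) := by
    have h3 : η ^ 2 = ((T : ℝ) ^ (2 * β))⁻¹ / 4 := by
      rw [hη, div_pow, ← Real.rpow_natCast, ← Real.rpow_mul hT0.le, ← Real.rpow_neg hT0.le]
      norm_num
      ring_nf
    rw [h3]
    field_simp
  have h2 : (Set.ncard {t : Fin T | lam t / 2 ≤ η} : ℝ) ≤ A * (T : ℝ) ^ (2 * β) := by
    have h3 := hsoft η ⟨hη0, by linarith⟩
    have h4 : η ^ (α / (1 - α)) ≤ (T : ℝ) ^ (2 * β - 1) := by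
      calc η ^ (α / (1 - α)) ≤ ((T : ℝ) ^ (-β)) ^ (α / (1 - α)) :=
            Real.rpow_le_rpow hη0.le (by linarith) (by positivity)
        _ = _ := by
            rw [← Real.rpow_mul hT0.le]
            congr 1
            rw [hβ]
            field_simp
            ring
    rw [Real.rpow_sub_one hT0.ne'] at h4
    have h5 := h3.trans (mul_le_mul_of_nonneg_left h4 hA.le)
    rw [one_div, ← mul_div_assoc, inv_mul_eq_div] at h5
    exact (div_le_div_iff_of_pos_right hT0).1 h5
  rw [h1]
  linarith

end Upper

/-! ### Lower bound: two constant hypotheses that are hard to distinguish. -/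

section Lower

/-- The distribution of a label `y` mixed with a uniform label. -/
noncomputable def mixDist (l : ℝ) (hl : l ∈ Set.Icc (0 : ℝ) 1) (y : Bool) : Dist Bool :=
  ⟨l • (Pi.single y 1 : Bool → ℝ) + (1 - l) • (fun _ => (1 / 2 : ℝ)), by
    obtain ⟨h0, h1⟩ := hl
    constructor
    · intro b
      simp only [Pi.add_apply, Pi.smul_apply, Pi.single_apply, smul_eq_mul]
      split_ifs <;> nlinarith
    · rw [Fintype.sum_bool]
      cases y <;> simp <;> ring⟩

lemma mixDist_apply (l : ℝ) (hl : l ∈ Set.Icc (0 : ℝ) 1) (y b : Bool) :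
    mixDist l hl y b = l * (if b = y then 1 else 0) + (1 - l) * (1 / 2) := by
  change (l • (Pi.single y 1 : Bool → ℝ) + (1 - l) • (fun _ => (1 / 2 : ℝ)) : Bool → ℝ) b = _
  simp [Pi.single_apply]

/-- Independence of `b` makes the product of the two sequence laws constant, as `two_point_bound`
requires. -/
lemma mixDist_mul (l : ℝ) (hl : l ∈ Set.Icc (0 : ℝ) 1) (b : Bool) :
    mixDist l hl false b * mixDist l hl true b = (1 - l ^ 2) / 4 := by
  rw [mixDist_apply, mixDist_apply]
  cases b <;> simp <;> ring

/-- Two label laws whose product is constant cannot be told apart: the total error of any test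
is bounded from below. -/
lemma two_point_bound {W : Type*} [Fintype W] (P Q a : W → ℝ) (hP : ∀ w, 0 ≤ P w)
    (hQ : ∀ w, 0 ≤ Q w) (ha : ∀ w, a w ∈ Set.Icc (0 : ℝ) 1) (hP1 : ∑ w, P w = 1)
    (hQ1 : ∑ w, Q w = 1) {c : ℝ} (hc : 0 ≤ c) (hPQ : ∀ w, P w * Q w = c) :
    c * (Fintype.card W : ℝ) ^ 2 / 2 ≤ ∑ w, P w * a w + ∑ w, Q w * (1 - a w) := by
  have h1 : ∑ w, min (P w) (Q w) ≤ ∑ w, P w * a w + ∑ w, Q w * (1 - a w) := by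
    rw [← sum_add_distrib]
    refine sum_le_sum fun w _ => ?_
    obtain ⟨h0, h1⟩ := ha w
    nlinarith [mul_le_mul_of_nonneg_right (min_le_left (P w) (Q w)) h0,
      mul_le_mul_of_nonneg_right (min_le_right (P w) (Q w)) (sub_nonneg.2 h1)]
  have h2 : ∑ w, max (P w) (Q w) ≤ 2 := by
    calc _ ≤ ∑ w, (P w + Q w) := sum_le_sum fun w _ =>
          max_le_add_of_nonneg (hP w) (hQ w)
      _ = 2 := by rw [sum_add_distrib, hP1, hQ1]; norm_num
  -- Cauchy–Schwarz with min · max = P · Q = c: the overlap ∑ min is at least (∑ √c)² / 2.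
  have h3 := sum_sq_le_sum_mul_sum_of_sq_le_mul univ (r := fun _ : W => √c)
    (f := fun w => min (P w) (Q w)) (g := fun w => max (P w) (Q w))
    (fun w _ => le_min (hP w) (hQ w)) (fun w _ => (hP w).trans (le_max_left _ _))
    (fun w _ => by rw [Real.sq_sqrt hc, min_mul_max, hPQ])
  rw [sum_const, card_univ, nsmul_eq_mul, mul_pow, Real.sq_sqrt hc] at h3
  have h4 : 0 ≤ ∑ w, min (P w) (Q w) := sum_nonneg fun w _ => le_min (hP w) (hQ w)
  nlinarith

/-- With one feature and both constant hypotheses, small mixing parameters on the first `n` steps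
force a linear number of errors on these steps. -/
lemma le_minimaxRisk_const {X : Type*} (x : X) {T : ℕ} (lam : Fin T → ℝ)
    (hlam : ∀ t, lam t ∈ Set.Icc (0 : ℝ) 1) {n : ℕ} (hn : n ≤ T) {ε : ℝ}
    (hε : ∀ t : Fin T, (t : ℕ) < n → lam t = ε) (hε1 : ε ^ 2 ≤ 1) (hnε : n * ε ^ 2 ≤ 1) :
    ENNReal.ofReal (n / 8) ≤
      minimaxRisk {fun _ : X => false, fun _ => true} {tsybakovKernel X lam} := by
  refine le_iInf fun Φ => ?_
  set ψ : FeatureRule X Bool T := fun _ _ => x with hψ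
  set p : Bool → NoiseRule Bool T := fun y t _ => mixDist (lam t) (hlam t) y with hp
  have hadm : ∀ y, Admissible (tsybakovKernel X lam) (fun _ => y) ψ (p y) :=
    fun y t w => ⟨lam t, le_rfl, (hlam t).2, rfl⟩
  have hsup : ∀ y : Bool, ENNReal.ofReal (expectedError Φ (fun _ => y) ψ (p y)) ≤
      ⨆ K ∈ ({tsybakovKernel X lam} : Set (Kernel X Bool Bool T)),
      ⨆ h ∈ ({fun _ : X => false, fun _ => true} : Set (X → Bool)),
      ⨆ ψ : FeatureRule X Bool T, ⨆ p : NoiseRule Bool T,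
      ⨆ _ : Admissible K h ψ p, ENNReal.ofReal (expectedError Φ h ψ p) := by
    intro y
    refine le_iSup₂_of_le (tsybakovKernel X lam) rfl (le_iSup₂_of_le (fun _ => y) ?_
      (le_iSup_of_le ψ (le_iSup_of_le (p y) (le_iSup_of_le (hadm y) le_rfl))))
    cases y <;> simp
  have hstep : ∀ t : Fin T, (t : ℕ) < n → (1 - t * ε ^ 2) / 2 ≤
      ∑ z, jointProb (p false) z * Φ t (features ψ z t) (past z t) true +
      ∑ z, jointProb (p true) z * Φ t (features ψ z t) (past z t) false := by
    intro t ht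
    set a : (Fin t → Bool) → ℝ := fun w => Φ t (fun _ => x) w true with ha
    have hfalse : ∀ w, Φ t (fun _ => x) w false = 1 - a w := fun w => by
      have := dist_sum (Φ t (fun _ => x) w)
      rw [Fintype.sum_bool] at this
      linarith
    have ha01 : ∀ w, a w ∈ Set.Icc (0 : ℝ) 1 := fun w =>
      ⟨dist_nonneg _ _, by linarith [hfalse w, dist_nonneg (Φ t (fun _ => x) w) false]⟩
    have e1 : ∑ z, jointProb (p false) z * Φ t (features ψ z t) (past z t) true = _ :=
      sum_jointProb_past (p false) t a
    have e2 : ∑ z, jointProb (p true) z * Φ t (features ψ z t) (past z t) false =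
        ∑ w, jointProb ((p true).restrict t.isLt.le) w * (1 - a w) := by
      simp_rw [← hfalse]
      exact sum_jointProb_past (p true) t fun w => Φ t (fun _ => x) w false
    rw [e1, e2]
    have hprod : ∀ w : Fin t → Bool, jointProb ((p false).restrict t.isLt.le) w *
        jointProb ((p true).restrict t.isLt.le) w = ((1 - ε ^ 2) / 4) ^ (t : ℕ) := by
      intro w
      unfold jointProb
      rw [← prod_mul_distrib]
      have : ∀ s : Fin t, (p false).restrict t.isLt.le s (past w s) (w s) *
          (p true).restrict t.isLt.le s (past w s) (w s) = (1 - ε ^ 2) / 4 := fun s => by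
        rw [← hε (Fin.castLE t.isLt.le s) (s.isLt.trans ht)]
        exact mixDist_mul _ (hlam _) _
      rw [prod_congr rfl fun s _ => this s, prod_const, card_univ, Fintype.card_fin]
    refine le_trans ?_ (two_point_bound _ _ a (jointProb_nonneg _) (jointProb_nonneg _) ha01
      (sum_jointProb _) (sum_jointProb _) (pow_nonneg (by linarith) _) hprod)
    have hc : ((1 - ε ^ 2) / 4) ^ (t : ℕ) * (Fintype.card (Fin t → Bool) : ℝ) ^ 2 =
        (1 + -ε ^ 2) ^ (t : ℕ) := by
      rw [Fintype.card_fun, Fintype.card_bool, Fintype.card_fin]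
      push_cast
      rw [← pow_mul, mul_comm (t : ℕ) 2, pow_mul, ← mul_pow]
      congr 1
      ring
    rw [hc]
    -- Bernoulli: the overlap decays at most linearly in t ε².
    have := one_add_mul_le_pow (a := -ε ^ 2) (by linarith) (t : ℕ)
    linarith
  have hsum : (n : ℝ) / 4 ≤ expectedError Φ (fun _ => false) ψ (p false) +
      expectedError Φ (fun _ => true) ψ (p true) := by
    rw [expectedError_eq, expectedError_eq, ← sum_add_distrib]
    simp only [Bool.not_false, Bool.not_true]
    have h1 : ∑ t : Fin n, (1 - (t : ℕ) * ε ^ 2) / 2 ≤ ∑ t : Fin T,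
        (∑ z, jointProb (p false) z * Φ t (features ψ z t) (past z t) true +
        ∑ z, jointProb (p true) z * Φ t (features ψ z t) (past z t) false) := by
      calc _ ≤ ∑ t : Fin n, (∑ z, jointProb (p false) z *
            Φ (Fin.castLE hn t) (features ψ z (Fin.castLE hn t))
              (past z (Fin.castLE hn t)) true +
          ∑ z, jointProb (p true) z *
            Φ (Fin.castLE hn t) (features ψ z (Fin.castLE hn t))
              (past z (Fin.castLE hn t)) false) :=
            sum_le_sum fun t _ => hstep (Fin.castLE hn t) t.isLt
        _ = ∑ t ∈ univ.map (Fin.castLEEmb hn), (∑ z, jointProb (p false) z *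
            Φ t (features ψ z t) (past z t) true +
          ∑ z, jointProb (p true) z * Φ t (features ψ z t) (past z t) false) := by
            rw [sum_map]; rfl
        _ ≤ _ := sum_le_sum_of_subset_of_nonneg (subset_univ _) fun t _ _ =>
            add_nonneg
              (sum_nonneg fun z _ => mul_nonneg (jointProb_nonneg _ _) (dist_nonneg _ _))
              (sum_nonneg fun z _ => mul_nonneg (jointProb_nonneg _ _) (dist_nonneg _ _))
    refine le_trans ?_ h1
    rw [Fin.sum_univ_eq_sum_range fun m : ℕ => (1 - (m : ℝ) * ε ^ 2) / 2]
    have h2 : ∀ m : ℕ, ∑ i ∈ range m, (1 - (i : ℝ) * ε ^ 2) / 2 =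
        m / 2 - m * (m - 1) * ε ^ 2 / 4 := by
      intro m
      induction m with
      | zero => simp
      | succ m ih => rw [sum_range_succ, ih]; push_cast; ring
    rw [h2]
    have hn0 : (0 : ℝ) ≤ n := n.cast_nonneg
    nlinarith [mul_le_mul_of_nonneg_left hnε hn0, mul_nonneg hn0 (sq_nonneg ε)]
  -- The worse of the two hypotheses carries at least half of n/4.
  rcases le_total (expectedError Φ (fun _ => false) ψ (p false))
    (expectedError Φ (fun _ => true) ψ (p true)) with hle | hle
  · exact (ENNReal.ofReal_le_ofReal (by linarith)).trans (hsup true)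
  · exact (ENNReal.ofReal_le_ofReal (by linarith)).trans (hsup false)

lemma exists_softConstraint_le_minimaxRisk {X : Type*} (x : X) {α A : ℝ} (hα0 : 0 ≤ α)
    (hα1 : α < 1) (hA : (2 : ℝ) ^ (α / (1 - α)) ≤ A) {T : ℕ} (hT : 1 ≤ T) :
    ∃ lam : Fin T → ℝ, SoftConstraint A α lam ∧
      ENNReal.ofReal (1 / 16 * (T : ℝ) ^ (2 * (1 - α) / (2 - α))) ≤
        minimaxRisk {fun _ : X => false, fun _ => true} {tsybakovKernel X lam} := by
  set β : ℝ := (1 - α) / (2 - α) with hβ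
  have h1α : 0 < 1 - α := by linarith
  have h2α : 0 < 2 - α := by linarith
  have hT1 : (1 : ℝ) ≤ T := by exact_mod_cast hT
  have hT0 : (0 : ℝ) < T := by linarith
  have hβ0 : 0 ≤ β := by positivity
  have hβ1 : 2 * β ≤ 1 := by
    rw [hβ, ← mul_div_assoc, div_le_one h2α]
    linarith
  have hexp : 2 * (1 - α) / (2 - α) = 2 * β := by rw [hβ]; ring
  set ε : ℝ := (T : ℝ) ^ (-β) with hε
  have hε1 : ε ≤ 1 := Real.rpow_le_one_of_one_le_of_nonpos hT1 (by linarith)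
  have hε0 : 0 < ε := Real.rpow_pos_of_pos hT0 _
  have hε2 : ε ^ 2 = ((T : ℝ) ^ (2 * β))⁻¹ := by
    rw [hε, ← Real.rpow_natCast, ← Real.rpow_mul hT0.le, ← Real.rpow_neg hT0.le]
    norm_num
    ring_nf
  have hεα : ε ^ (α / (1 - α)) = (T : ℝ) ^ (2 * β) / T := by
    rw [hε, ← Real.rpow_mul hT0.le, ← Real.rpow_sub_one hT0.ne']
    congr 1
    rw [hβ]
    field_simp
    ring
  set R : ℝ := (T : ℝ) ^ (2 * β) with hR
  have hR1 : 1 ≤ R := Real.one_le_rpow hT1 (by positivity)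
  -- Since R = ε⁻², this is the longest phase with n ε² ≤ 1. As n ≥ 1, R < n + 1 ≤ 2n, which turns
  -- n/8 into R/16.
  set n : ℕ := ⌊R⌋₊ with hn
  have hnR : (n : ℝ) ≤ R := Nat.floor_le (by linarith)
  have hRn : R < n + 1 := Nat.lt_floor_add_one R
  have hn1 : (1 : ℝ) ≤ n := by exact_mod_cast Nat.le_floor (by exact_mod_cast hR1)
  have hRT : R ≤ T := by
    calc R ≤ (T : ℝ) ^ (1 : ℝ) := Real.rpow_le_rpow_of_exponent_le hT1 hβ1
      _ = T := Real.rpow_one _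
  have hnT : n ≤ T := by exact_mod_cast hnR.trans hRT
  set lam : Fin T → ℝ := fun t => if (t : ℕ) < n then ε else 1 with hlamdef
  have hlam : ∀ t, lam t ∈ Set.Icc (0 : ℝ) 1 := by
    intro t
    simp only [hlamdef]
    split_ifs
    · exact ⟨hε0.le, hε1⟩
    · simp
  refine ⟨lam, ⟨hlam, fun r hr => ?_⟩, ?_⟩
  · obtain ⟨hr0, hr1⟩ := hr
    have ha0 : 0 ≤ α / (1 - α) := by positivity
    -- The lower bound on A reduces the constraint to (2r)^(α/(1-α)). It is trivial at r = 1/2 and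
    -- for 2r < ε, where no step counts; for ε ≤ 2r < 1 at most n ≤ R steps count, and R/T =
    -- ε^(α/(1-α)).
    have hAr : (2 * r) ^ (α / (1 - α)) ≤ A * r ^ (α / (1 - α)) := by
      rw [Real.mul_rpow (by norm_num) hr0.le]
      exact mul_le_mul_of_nonneg_right hA (Real.rpow_nonneg hr0.le _)
    refine le_trans ?_ hAr
    rw [one_div, inv_mul_eq_div]
    rcases hr1.eq_or_lt with rfl | hr2
    · norm_num
      rw [div_le_one hT0]
      have := Set.ncard_le_card {t : Fin T | lam t / 2 ≤ 1 / 2}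
      rw [Nat.card_eq_fintype_card, Fintype.card_fin] at this
      exact_mod_cast this
    · rcases lt_or_ge (2 * r) ε with hrε | hrε
      · have : {t : Fin T | lam t / 2 ≤ r} = ∅ := by
          ext t
          simp only [hlamdef, Set.mem_ofPred_eq, Set.mem_empty_iff_false, iff_false, not_le]
          split_ifs <;> linarith
        rw [this]
        simp only [Set.ncard_empty, Nat.cast_zero, zero_div]
        positivity
      · have hsub : {t : Fin T | lam t / 2 ≤ r} ⊆ Set.range (Fin.castLE hnT) := by
          intro t ht
          simp only [hlamdef, Set.mem_ofPred_eq] at ht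
          split_ifs at ht with htn
          · exact ⟨⟨t, htn⟩, rfl⟩
          · linarith
        have hcard : Set.ncard {t : Fin T | lam t / 2 ≤ r} ≤ n := by
          refine (Set.ncard_le_ncard hsub (Set.toFinite _)).trans ?_
          rw [← Set.image_univ]
          refine (Set.ncard_image_le (Set.toFinite _)).trans ?_
          simp
        calc (Set.ncard {t : Fin T | lam t / 2 ≤ r} : ℝ) / T ≤ R / T := by
              gcongr
              exact le_trans (by exact_mod_cast hcard) hnR
          _ = ε ^ (α / (1 - α)) := hεα.symm
          _ ≤ _ := Real.rpow_le_rpow hε0.le hrε ha0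
  · refine le_trans (ENNReal.ofReal_le_ofReal ?_) (le_minimaxRisk_const x lam hlam hnT (ε := ε)
      (fun t ht => if_pos ht) (by nlinarith) ?_)
    · rw [hexp]
      linarith
    · rw [hε2, ← div_eq_mul_inv, div_le_one (by linarith)]
      exact hnR

end Lower

end NoisyOnline

theorem mainTheorem7 (α : ℝ) (hα0 : 0 ≤ α) (hα1 : α < 1) :
    (∀ A : ℝ, 0 < A → ∃ C : ℝ, 0 < C ∧ ∃ k : ℕ,
      ∀ (X : Type u) (H : Set (X → Bool)), H.Finite → H.Nonempty → ∀ T : ℕ, 1 ≤ T →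
        NoisyOnline.minimaxRisk H (NoisyOnline.tsybakovFamily X T A α) ≤
          ENNReal.ofReal (C * (1 + Real.log T) ^ k * (1 + Real.log H.ncard) ^ k *
            (T : ℝ) ^ (2 * (1 - α) / (2 - α)))) ∧
    (∃ (X : Type u) (H : Set (X → Bool)), H.Finite ∧ H.Nonempty ∧
      ∀ A : ℝ, (2 : ℝ) ^ (α / (1 - α)) ≤ A → ∃ c : ℝ, 0 < c ∧ ∃ k : ℕ,
        ∀ T : ℕ, 1 ≤ T → ∃ lam : Fin T → ℝ, NoisyOnline.SoftConstraint A α lam ∧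
          ENNReal.ofReal (c * (T : ℝ) ^ (2 * (1 - α) / (2 - α)) / (1 + Real.log T) ^ k) ≤
            NoisyOnline.minimaxRisk H {NoisyOnline.tsybakovKernel X lam}) := by
  constructor
  · intro A hA
    -- The log T factor is not needed; k = 1 serves for log|H|.
    refine ⟨4 + 2 * A, by linarith, 1, fun X H hH hne T hT => ?_⟩
    refine (NoisyOnline.minimaxRisk_tsybakovFamily_le hα0 hα1 hA H hH hne hT).trans
      (ENNReal.ofReal_le_ofReal (mul_le_mul_of_nonneg_right ?_ (by positivity)))
    have h1 : 0 ≤ Real.log T := Real.log_natCast_nonneg T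
    have h2 : 0 ≤ Real.log H.ncard := Real.log_natCast_nonneg _
    have h3 : 0 ≤ (4 + 2 * A) * (1 + Real.log H.ncard) := by positivity
    nlinarith [mul_nonneg h3 h1, mul_nonneg hA.le h2]
  · refine ⟨PUnit, {fun _ => false, fun _ => true}, by simp, by simp, fun A hA =>
      ⟨1 / 16, by norm_num, 0, fun T hT => ?_⟩⟩
    simpa only [pow_zero, div_one] using
      NoisyOnline.exists_softConstraint_le_minimaxRisk PUnit.unit hα0 hα1 hA hT
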